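/- Let $n\ge 1$ and consider a ring of $n$ qubits (the spin chain, $\mathcal H_{\rm spin}=(\mathbb C^2)^{\otimes n}$) and a parallel ring of $n$ fermionic modes (the clock), with creation operators $c_t^\dagger$, $t\in\{0,\dots,n-1\}$, and vacuum $|\Omega\rangle$. Let $u_0,\dots,u_{n-1}$ be unitaries on $\mathcal H_{\rm spin}$ such that $u_t$ is supported on the qubits $t$ and $t+1 \bmod n$, and $u_{n-1}\propto \mathbb 1$. Put $U_{t:0}=u_{t-1}\cdots u_1u_0$ for $0\le t\le n$ (with $U_{0:0}=\mathbb 1$). Let $|\phi\rangle\in\mathcal H_{\rm spin}$ be a unit vector and $\phi\in\mathbb R$ with $U_{n:0}|\phi\rangle=e^{i\phi}|\phi\rangle$. An $m$-hand configuration is a vector $\mathbf t=(t_1<\dots<t_m)$ in $\{0,\dots,n-1\}^m$, $m\ge 0$; for it put $U_{\mathbf t:0}=U_{t_1:0}U_{t_2:0}\cdots U_{t_m:0}$ and $c_{\mathbf t}^\dagger=c_{t_1}^\dagger\cdots c_{t_m}^\dagger$. Let $\mathbf k=(k_1,\dots,k_M)$, $M\ge 0$, be pairwise distinct momenta in $\tfrac{2\pi}{n}\{0,\dots,n-1\}$,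 and for an $M$-hand configuration $\mathbf t$ put $$\varphi_{\mathbf k,\phi}(\mathbf t)=\frac1{n^{M/2}}\sum_{\sigma\in S_M}\operatorname{sign}(\sigma)\,e^{i\sum_{j=1}^M (k_j-\phi/n)\,t_{\sigma(j)}},\qquad c^\dagger_{\mathbf k,\phi}=\sum_{\mathbf t}\varphi_{\mathbf k,\phi}(\mathbf t)\,c^\dagger_{\mathbf t},$$ where $\mathbf t$ runs over all $M$-hand configurations, and define the $M$-hand clock eigenstate $$|\Psi_{\mathbf k,\phi}\rangle=\sum_{\mathbf t}\varphi_{\mathbf k,\phi}(\mathbf t)\;U_{\mathbf t:0}|\phi\rangle\otimes c^\dagger_{\mathbf t}|\Omega\rangle .$$ Let $A=\{a,a+1,\dots,a+\ell-1\}\bmod n$ with $0\le\ell\le n$ be any interval of the ring. It denotes a subsystem of the spin chain (the qubits in $A$), of the clock (the modes in $A$, in the occupation number basis), and of the spin-clock ladder (both). For a pure state $\psi$ let $S^{(2)}_A(\psi)=-\ln\operatorname{Tr}(\rho_A^2)$, where $\rho_A$ is the reduced density matrix of $\psi$ on $A$. Then $$c^\dagger_{\mathbf k,\phi}=\prod_{j=1}^M\Big[\frac1{\sqrt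 n}\sum_{t=0}^{n-1}e^{i(k_j-\phi/n)t}c_t^\dagger\Big]$$ (product taken in the order $j=1,\dots,M$ from left to right), and $$S^{(2)}_A\big(|\Psi_{\mathbf k,\phi}\rangle\big)\;\ge\;S^{(2)}_A\big(c^\dagger_{\mathbf k,\phi}|\Omega\rangle\big)+\min_{\mathbf t}S^{(2)}_A\big(U_{\mathbf t:0}|\phi\rangle\big),$$ where the minimum is over all hand configurations $\mathbf t$ with at most $M$ hands. -/

import Mathlib

open scoped BigOperators Matrix

noncomputable section

namespace SpinClock

/-- A wave function on a chain of `n` sites with local basis `κ`: its coefficients in the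
product basis, which is labelled by the maps `Fin n → κ`. -/
abbrev State (n : ℕ) (κ : Type) : Type := (Fin n → κ) → ℂ

/-- An operator on such a chain, as its matrix in the product basis. -/
abbrev Op (n : ℕ) (κ : Type) : Type := Matrix (Fin n → κ) (Fin n → κ) ℂ

/-! ### Subsystems and the second Renyi entropy -/

/-- The interval `{a, a + 1, …, a + ℓ - 1}` modulo `n` of the ring of `n` sites. -/
def ringInterval {n : ℕ} (a : Fin n) (ℓ : ℕ) : Finset (Fin n) :=
  Finset.univ.filter fun i => ∃ j < ℓ, (i : ℕ) = ((a : ℕ) + j) % n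

/-- The basis label of the whole chain with label `x` on the sites in `A` and `y` off `A`. -/
def glue {n : ℕ} {κ : Type} (A : Finset (Fin n)) (x : {i // i ∈ A} → κ)
    (y : {i // i ∉ A} → κ) : Fin n → κ :=
  fun i => if h : i ∈ A then x ⟨i, h⟩ else y ⟨i, h⟩

/-- The reduced density matrix on `A` of the pure state `ψ`, i.e. the partial trace of
`|ψ⟩⟨ψ|` over the sites that are not in `A`. -/
def reducedDensity {n : ℕ} {κ : Type} [Fintype κ] (A : Finset (Fin n)) (ψ : State n κ) :
    Matrix ({i // i ∈ A} → κ) ({i // i ∈ A} → κ) ℂ :=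
  fun x x' => ∑ y : {i // i ∉ A} → κ, ψ (glue A x y) * star (ψ (glue A x' y))

/-- The second Renyi entropy `- ln Tr (ρ_A ^ 2)` of the pure state `ψ`. The trace is a
real number, so that nothing is lost by taking its real part. -/
def renyi2 {n : ℕ} {κ : Type} [Fintype κ] (A : Finset (Fin n)) (ψ : State n κ) : ℝ :=
  -Real.log (Matrix.trace (reducedDensity A ψ * reducedDensity A ψ)).re

/-! ### The circuit on the spin chain -/

/-- The operator `O` on `n` qubits is supported on the set `S` of qubits: it is the tensor
product of an operator `g` on the qubits in `S` with the identity on all the others. -/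
def SupportedOn {n : ℕ} (S : Finset (Fin n)) (O : Op n (Fin 2)) : Prop :=
  ∃ g : Matrix ({i // i ∈ S} → Fin 2) ({i // i ∈ S} → Fin 2) ℂ, ∀ x y : Fin n → Fin 2,
    O x y = if ∀ i, i ∉ S → x i = y i then g (fun i => x i) (fun i => y i) else 0

/-- The propagator `U_{t:0} = u_{t-1} ⋯ u_1 u_0`, for `0 ≤ t ≤ n`. -/
def propagator {n : ℕ} (u : Fin n → Op n (Fin 2)) : ℕ → Op n (Fin 2)
  | 0 => 1
  | t + 1 => (if h : t < n then u ⟨t, h⟩ else 1) * propagator u t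

/-- A configuration `t_1 < t_2 < ⋯ < t_M` of `M` clock hands. -/
abbrev HandConfig (n M : ℕ) : Type := {t : Fin M → Fin n // StrictMono t}

instance (n M : ℕ) : Fintype (HandConfig n M) := Fintype.ofFinite _

/-- The configuration without hands. -/
instance (n M : ℕ) : Nonempty (Σ m : Fin (M + 1), HandConfig n m) :=
  ⟨⟨0, ⟨fun i => i.elim0, fun i => i.elim0⟩⟩⟩

/-- The many-hand propagator `U_{t_1:0} U_{t_2:0} ⋯ U_{t_M:0}`. -/
def handPropagator {n M : ℕ} (u : Fin n → Op n (Fin 2)) (t : HandConfig n M) : Op n (Fin 2) :=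
  (List.ofFn fun j => propagator u (t.1 j : ℕ)).prod

/-! ### The fermionic clock

The Fock space of `n` fermionic modes has the occupation number basis `Fin n → Bool`. -/

/-- The creation operator of a fermion on site `j`. -/
def create {n : ℕ} (j : Fin n) : Op n Bool :=
  fun x y => if y j = false ∧ x = Function.update y j true then
    (-1) ^ (Finset.univ.filter fun i => i < j ∧ y i = true).card else 0

/-- The fermionic vacuum. -/
def vacuum (n : ℕ) : State n Bool := fun x => if ∀ i, x i = false then 1 else 0

/-- The operator that creates `c†_{t_1} c†_{t_2} ⋯ c†_{t_M}`. -/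
def handCreate {n M : ℕ} (t : HandConfig n M) : Op n Bool :=
  (List.ofFn fun j => create (t.1 j)).prod

/-- The twisted momentum `2 π q / n - θ / n` with `q ∈ {0, …, n - 1}`. -/
def twistedMomentum {n : ℕ} (θ : ℝ) (q : Fin n) : ℝ := 2 * Real.pi * (q : ℕ) / n - θ / n

/-- The coefficient of the normalized Slater determinant of plane waves at the hand positions
`t`, for the momenta `2 π q_j / n` and boundary conditions twisted by `θ`. -/
def slaterCoeff {n M : ℕ} (q : Fin M → Fin n) (θ : ℝ) (t : HandConfig n M) : ℂ :=
  ((Real.sqrt n : ℝ) : ℂ)⁻¹ ^ M * ∑ σ : Equiv.Perm (Fin M),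
    ((Equiv.Perm.sign σ : ℤ) : ℂ) *
      Complex.exp (Complex.I * ∑ j, ((twistedMomentum θ (q j) * ((t.1 (σ j) : ℕ) : ℝ) : ℝ) : ℂ))

/-- The creation operator of the Slater determinant. -/
def slaterCreate {n M : ℕ} (q : Fin M → Fin n) (θ : ℝ) : Op n Bool :=
  ∑ t : HandConfig n M, slaterCoeff q θ t • handCreate t

/-- The creation operator of a single fermion in a plane wave with twisted momentum. -/
def planeWaveCreate {n : ℕ} (q : Fin n) (θ : ℝ) : Op n Bool :=
  ((Real.sqrt n : ℝ) : ℂ)⁻¹ • ∑ t : Fin n,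
    Complex.exp (Complex.I * ((twistedMomentum θ q * ((t : ℕ) : ℝ) : ℝ) : ℂ)) • create t

/-! ### The spin-clock ladder -/

/-- The product state of a spin state and a clock state, on the ladder: site `i` carries
qubit `i` and clock mode `i`. -/
def ladderTensor {n : ℕ} (ψ : State n (Fin 2)) (χ : State n Bool) : State n (Fin 2 × Bool) :=
  fun x => ψ (fun i => (x i).1) * χ (fun i => (x i).2)

/-- The Krylov state `U_{t:0} |φ⟩ ⊗ c†_t |Ω⟩`. -/
def krylov {n M : ℕ} (u : Fin n → Op n (Fin 2)) (φ : State n (Fin 2)) (t : HandConfig n M) :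
    State n (Fin 2 × Bool) :=
  ladderTensor (handPropagator u t *ᵥ φ) (handCreate t *ᵥ vacuum n)

/-- The many-hand clock eigenstate built from the Floquet state `φ` of phase `θ`. -/
def clockEigenstate {n M : ℕ} (u : Fin n → Op n (Fin 2)) (φ : State n (Fin 2)) (θ : ℝ)
    (q : Fin M → Fin n) : State n (Fin 2 × Bool) :=
  ∑ t : HandConfig n M, slaterCoeff q θ t • krylov u φ t

/-- The minimum of the second Renyi entropy of `U_{t:0} |φ⟩` over all hand configurations `t`
with at most `M` hands. -/
def minSpinRenyi2 {n : ℕ} (A : Finset (Fin n)) (u : Fin n → Op n (Fin 2))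
    (φ : State n (Fin 2)) (M : ℕ) : ℝ :=
  (Finset.univ : Finset (Σ m : Fin (M + 1), HandConfig n m)).inf' Finset.univ_nonempty
    fun t => renyi2 A (handPropagator u t.2 *ᵥ φ)

end SpinClock

end

/-! The product formula is the expansion of an alternating multilinear map. Creation operators
anticommute, so terms with repeated sites vanish and every other term is an increasing configuration
reordered by a permutation with its sign (`createMulti_eq_sum`).

For the entropy bound, fix a segment [p, r) of sites. Hands left of p act only left of p. By
causality of the circuit, hands inside the segment can be pushed to p, p+1, … at the cost of a
unitary on the segment (`exists_listPropagator_eq_mul`). Since u_{n-1} is a scalar, φ is an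
eigenvector of U_{n-1:0}, so a hand at t acts on φ as the inverse of the remaining gates, which live
on the sites from t on (`exists_listPropagator_mulVec_eq`). So, up to unitaries on the segment and
on its complement, the spin state depends only on the number of hands in the segment
(`exists_local_factorization`).

The clock has exactly M hands, so clock configurations on A that share a configuration off A have
equally many hands. Each clock block (a, a') of the ladder's reduced density matrix is therefore the
clock's entry times a spin density matrix X_a conjugated by two unitaries. The ladder purity is the
average of the purities of X_a with weights |ρ_clock(a, a')|² (`purity_ladder`). Bounding these by
the largest purity and taking logarithms gives the claim. -/

noncomputable section

namespace SpinClock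

open scoped Kronecker

/-! ### Splitting basis labels along a bipartition. -/

section Glue

variable {n : ℕ} {κ : Type}

theorem glue_mem (A : Finset (Fin n)) (x : {i // i ∈ A} → κ) (y : {i // i ∉ A} → κ)
    {i : Fin n} (h : i ∈ A) : glue A x y i = x ⟨i, h⟩ := by simp [glue, h]

theorem glue_notMem (A : Finset (Fin n)) (x : {i // i ∈ A} → κ) (y : {i // i ∉ A} → κ)
    {i : Fin n} (h : i ∉ A) : glue A x y i = y ⟨i, h⟩ := by simp [glue, h]

/-- Splitting a basis label into its restrictions to `A` and to the complement of `A`. -/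
def glueEquiv (A : Finset (Fin n)) (κ : Type) :
    ({i // i ∈ A} → κ) × ({i // i ∉ A} → κ) ≃ (Fin n → κ) where
  toFun p := glue A p.1 p.2
  invFun x := (fun i => x i, fun i => x i)
  left_inv p := by
    ext i
    · exact glue_mem _ _ _ i.2
    · exact glue_notMem _ _ _ i.2
  right_inv x := by
    funext i
    by_cases h : i ∈ A
    · exact glue_mem _ _ _ h
    · exact glue_notMem _ _ _ h

@[simp] theorem glueEquiv_apply (A : Finset (Fin n))
    (p : ({i // i ∈ A} → κ) × ({i // i ∉ A} → κ)) : glueEquiv A κ p = glue A p.1 p.2 := rfl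

@[simp] theorem glueEquiv_symm_apply (A : Finset (Fin n)) (x : Fin n → κ) :
    (glueEquiv A κ).symm x = ((fun i => x i : {i // i ∈ A} → κ), (fun i => x i : {i // i ∉ A} → κ)) :=
  rfl

end Glue

/-! ### Local operators, their tensor form and their action on coefficient matrices. -/

section Support

variable {n : ℕ}

theorem SupportedOn.exists_kronecker {S : Finset (Fin n)} {O : Op n (Fin 2)}
    (h : SupportedOn S O) :
    ∃ g, O.submatrix (glueEquiv S (Fin 2)) (glueEquiv S (Fin 2)) = g ⊗ₖ 1 := by
  obtain ⟨g, hg⟩ := h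
  refine ⟨g, ?_⟩
  ext ⟨x, y⟩ ⟨x', y'⟩
  have e1 : (fun i : {i // i ∈ S} => glue S x y i) = x := by
    funext i; exact glue_mem _ _ _ i.2
  have e2 : (fun i : {i // i ∈ S} => glue S x' y' i) = x' := by
    funext i; exact glue_mem _ _ _ i.2
  have e3 : (∀ i, i ∉ S → glue S x y i = glue S x' y' i) ↔ y = y' := by
    constructor
    · intro h; funext i
      have := h i i.2
      rwa [glue_notMem _ _ _ i.2, glue_notMem _ _ _ i.2] at this
    · rintro rfl i hi
      rw [glue_notMem _ _ _ hi, glue_notMem _ _ _ hi]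
  simp only [Matrix.submatrix_apply, glueEquiv_apply, hg, e1, e2, e3, Matrix.kroneckerMap_apply,
    Matrix.one_apply]
  split_ifs <;> simp

theorem supportedOn_of_kronecker {S : Finset (Fin n)} {O : Op n (Fin 2)} {g}
    (h : O.submatrix (glueEquiv S (Fin 2)) (glueEquiv S (Fin 2)) = g ⊗ₖ 1) :
    SupportedOn S O := by
  refine ⟨g, fun x y => ?_⟩
  have := congrFun (congrFun h ((glueEquiv S _).symm x)) ((glueEquiv S _).symm y)
  rw [Matrix.submatrix_apply, Equiv.apply_symm_apply, Equiv.apply_symm_apply] at this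
  rw [this]
  simp [Matrix.kroneckerMap_apply, Matrix.one_apply, funext_iff]

/-- An operator is supported on `S` if it acts trivially off `S`. -/
theorem supportedOn_iff {S : Finset (Fin n)} {O : Op n (Fin 2)} :
    SupportedOn S O ↔ (∀ x y, (∃ i, i ∉ S ∧ x i ≠ y i) → O x y = 0) ∧
      ∀ x y x' y', (∀ i, i ∉ S → x i = y i) → (∀ i, i ∉ S → x' i = y' i) →
        (∀ i ∈ S, x i = x' i) → (∀ i ∈ S, y i = y' i) → O x y = O x' y' := by
  constructor
  · rintro ⟨g, hg⟩
    refine ⟨fun x y ⟨i, hi, h⟩ => ?_, fun x y x' y' h h' hx hy => ?_⟩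
    · rw [hg, if_neg fun H => h (H i hi)]
    · rw [hg, hg, if_pos h, if_pos h']
      congr 1
      · funext i; exact hx i i.2
      · funext i; exact hy i i.2
  · rintro ⟨h0, h1⟩
    refine ⟨fun x y => O (glue S x fun _ => 0) (glue S y fun _ => 0), fun x y => ?_⟩
    split_ifs with h
    · refine h1 _ _ _ _ h (fun i hi => ?_) (fun i hi => ?_) (fun i hi => ?_)
      · rw [glue_notMem _ _ _ hi, glue_notMem _ _ _ hi]
      · rw [glue_mem _ _ _ hi]
      · rw [glue_mem _ _ _ hi]
    · push Not at h
      exact h0 _ _ h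

theorem SupportedOn.mono {S T : Finset (Fin n)} {O : Op n (Fin 2)} (h : SupportedOn S O)
    (hST : S ⊆ T) : SupportedOn T O := by
  rw [supportedOn_iff] at h ⊢
  refine ⟨fun x y ⟨i, hi, hxy⟩ => h.1 x y ⟨i, fun H => hi (hST H), hxy⟩,
    fun x y x' y' hxy hxy' hx hy => ?_⟩
  by_cases H : ∀ i, i ∉ S → x i = y i
  · refine h.2 _ _ _ _ H (fun i hi => ?_) (fun i hi => hx i (hST hi)) (fun i hi => hy i (hST hi))
    by_cases hT : i ∈ T
    · rw [← hx i hT, ← hy i hT, H i hi]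
    · exact hxy' i hT
  · push Not at H
    obtain ⟨i, hi, hne⟩ := H
    have hT : i ∈ T := by
      by_contra hT
      exact hne (hxy i hT)
    rw [h.1 x y ⟨i, hi, hne⟩, h.1 x' y' ⟨i, hi, by rwa [← hx i hT, ← hy i hT]⟩]

/-- The labels on `A` lie off `S`, so they must agree and do not influence the entry; the second
factor can be read off with zeros on `A`. -/
theorem SupportedOn.exists_kronecker_of_disjoint {S A : Finset (Fin n)} {O : Op n (Fin 2)}
    (h : SupportedOn S O) (hSA : Disjoint S A) :
    ∃ g, O.submatrix (glueEquiv A (Fin 2)) (glueEquiv A (Fin 2)) = 1 ⊗ₖ g := by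
  rw [supportedOn_iff] at h
  refine ⟨fun y y' => O (glue A (fun _ => 0) y) (glue A (fun _ => 0) y'), ?_⟩
  have hA : ∀ i ∈ A, i ∉ S := fun i hi hS => (Finset.disjoint_left.1 hSA) hS hi
  ext ⟨x, y⟩ ⟨x', y'⟩
  change O (glue A x y) (glue A x' y') = (1 : Matrix _ _ ℂ) x x' *
    O (glue A (fun _ => 0) y) (glue A (fun _ => 0) y')
  rw [Matrix.one_apply]
  split_ifs with hx
  · subst hx
    rw [one_mul]
    by_cases H : ∀ i, i ∉ S → glue A x y i = glue A x y' i
    · refine h.2 _ _ _ _ H (fun i hi => ?_) (fun i hi => ?_) (fun i hi => ?_)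
      · by_cases hiA : i ∈ A
        · rw [glue_mem _ _ _ hiA, glue_mem _ _ _ hiA]
        · have := H i hi
          rwa [glue_notMem _ _ _ hiA, glue_notMem _ _ _ hiA] at this ⊢
      all_goals
        have hiA : i ∉ A := fun hh => hA i hh hi
        rw [glue_notMem _ _ _ hiA, glue_notMem _ _ _ hiA]
    · push Not at H
      obtain ⟨i, hi, hne⟩ := H
      have hiA : i ∉ A := fun hh => hne (by rw [glue_mem _ _ _ hh, glue_mem _ _ _ hh])
      rw [h.1 _ _ ⟨i, hi, hne⟩, h.1 _ _ ⟨i, hi, ?_⟩]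
      rwa [glue_notMem _ _ _ hiA, glue_notMem _ _ _ hiA] at hne ⊢
  · rw [zero_mul]
    obtain ⟨i, hi⟩ := Function.ne_iff.1 hx
    exact h.1 _ _ ⟨i, hA i i.2, by rwa [glue_mem _ _ _ i.2, glue_mem _ _ _ i.2]⟩

theorem submatrix_mul_equiv' {α β : Type} [Fintype α] [Fintype β] (e : α ≃ β)
    (O P : Matrix β β ℂ) : (O * P).submatrix e e = O.submatrix e e * P.submatrix e e :=
  (Matrix.submatrix_mul_equiv O P e e e).symm

/-- Along the splitting by `S` the two operators become g ⊗ 1 and 1 ⊗ g'. -/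
theorem SupportedOn.commute {S T : Finset (Fin n)} {O P : Op n (Fin 2)} (hO : SupportedOn S O)
    (hP : SupportedOn T P) (h : Disjoint S T) : O * P = P * O := by
  obtain ⟨g, hg⟩ := hO.exists_kronecker
  obtain ⟨g', hg'⟩ := hP.exists_kronecker_of_disjoint h.symm
  apply (Matrix.reindex (glueEquiv S (Fin 2)).symm (glueEquiv S (Fin 2)).symm).injective
  simp only [Matrix.reindex_apply, Equiv.symm_symm, submatrix_mul_equiv', hg, hg',
    ← Matrix.mul_kronecker_mul, mul_one, one_mul]

/-- The unitaries that are supported on `S`. -/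
def localUnitary (S : Finset (Fin n)) : Submonoid (Op n (Fin 2)) where
  carrier := {V | V ∈ Matrix.unitaryGroup (Fin n → Fin 2) ℂ ∧ SupportedOn S V}
  one_mem' := ⟨one_mem _, supportedOn_of_kronecker (g := 1) (by simp)⟩
  mul_mem' := by
    rintro V W ⟨hV, hV'⟩ ⟨hW, hW'⟩
    obtain ⟨g, hg⟩ := hV'.exists_kronecker
    obtain ⟨g', hg'⟩ := hW'.exists_kronecker
    refine ⟨mul_mem hV hW, supportedOn_of_kronecker (g := g * g') ?_⟩
    rw [submatrix_mul_equiv', hg, hg', ← Matrix.mul_kronecker_mul, mul_one]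

theorem localUnitary_mono {S T : Finset (Fin n)} (h : S ⊆ T) :
    localUnitary S ≤ localUnitary T := fun _ hV => ⟨hV.1, hV.2.mono h⟩

theorem localUnitary_commute {S T : Finset (Fin n)} {V W : Op n (Fin 2)}
    (hV : V ∈ localUnitary S) (hW : W ∈ localUnitary T) (h : Disjoint S T) : V * W = W * V :=
  hV.2.commute hW.2 h

theorem conjTranspose_mem_localUnitary {S : Finset (Fin n)} {V : Op n (Fin 2)}
    (hV : V ∈ localUnitary S) : Vᴴ ∈ localUnitary S := by
  obtain ⟨g, hg⟩ := hV.2.exists_kronecker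
  refine ⟨Unitary.star_mem hV.1, supportedOn_of_kronecker (g := gᴴ) ?_⟩
  rw [← Matrix.conjTranspose_submatrix, hg, Matrix.conjTranspose_kronecker,
    Matrix.conjTranspose_one]

theorem smul_mem_localUnitary {S : Finset (Fin n)} {V : Op n (Fin 2)}
    (hV : V ∈ localUnitary S) {c : ℂ} (hc : c * star c = 1) : c • V ∈ localUnitary S := by
  obtain ⟨g, hg⟩ := hV.2.exists_kronecker
  refine ⟨?_, supportedOn_of_kronecker (g := c • g) ?_⟩
  · have := Matrix.mem_unitaryGroup_iff.1 hV.1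
    rw [Matrix.mem_unitaryGroup_iff, star_smul, smul_mul_smul_comm, this, hc, one_smul]
  · rw [Matrix.smul_kronecker, ← hg]; rfl

/-- The coefficients of a state as a matrix between the subsystem `A` and its complement. -/
def coeffMatrix {κ : Type} (A : Finset (Fin n)) (ψ : State n κ) :
    Matrix ({i // i ∈ A} → κ) ({i // i ∉ A} → κ) ℂ :=
  fun x y => ψ (glue A x y)

theorem kronecker_one_unitary {α β : Type} [Fintype α] [DecidableEq α] [Fintype β]
    [DecidableEq β] [Nonempty β] {g : Matrix α α ℂ}
    (h : (g ⊗ₖ (1 : Matrix β β ℂ)) * (g ⊗ₖ (1 : Matrix β β ℂ))ᴴ = 1) : g * gᴴ = 1 := by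
  rw [Matrix.conjTranspose_kronecker, Matrix.conjTranspose_one, ← Matrix.mul_kronecker_mul,
    mul_one] at h
  ext x x'
  have b := Classical.arbitrary β
  have := congrFun (congrFun h (x, b)) (x', b)
  simpa [Matrix.kroneckerMap_apply, Matrix.one_apply] using this

theorem one_kronecker_unitary {α β : Type} [Fintype α] [DecidableEq α] [Fintype β]
    [DecidableEq β] [Nonempty β] {g : Matrix α α ℂ}
    (h : ((1 : Matrix β β ℂ) ⊗ₖ g) * ((1 : Matrix β β ℂ) ⊗ₖ g)ᴴ = 1) : g * gᴴ = 1 := by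
  rw [Matrix.conjTranspose_kronecker, Matrix.conjTranspose_one, ← Matrix.mul_kronecker_mul,
    mul_one] at h
  ext x x'
  have b := Classical.arbitrary β
  have := congrFun (congrFun h (b, x)) (b, x')
  simpa [Matrix.kroneckerMap_apply, Matrix.one_apply] using this

theorem coeffMatrix_mulVec_of_mem {A : Finset (Fin n)} {V : Op n (Fin 2)}
    (hV : V ∈ localUnitary A) :
    ∃ g : Matrix ({i // i ∈ A} → Fin 2) ({i // i ∈ A} → Fin 2) ℂ, g * gᴴ = 1 ∧
      ∀ ψ : State n (Fin 2), coeffMatrix A (V *ᵥ ψ) = g * coeffMatrix A ψ := by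
  obtain ⟨g, hg⟩ := hV.2.exists_kronecker
  refine ⟨g, ?_, fun ψ => ?_⟩
  · apply kronecker_one_unitary (β := {i // i ∉ A} → Fin 2)
    rw [← hg, Matrix.conjTranspose_submatrix, ← submatrix_mul_equiv']
    have := Matrix.mem_unitaryGroup_iff.1 hV.1
    rw [Matrix.star_eq_conjTranspose] at this
    rw [this, Matrix.submatrix_one_equiv]
  · ext x y
    change ∑ z, V (glue A x y) z * ψ z = _
    rw [← (glueEquiv A (Fin 2)).sum_comp, Fintype.sum_prod_type]
    have : ∀ x' y', V (glue A x y) (glue A x' y') = g x x' * (1 : Matrix _ _ ℂ) y y' :=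
      fun x' y' => congrFun (congrFun hg (x, y)) (x', y')
    simp [this, Matrix.mul_apply, Matrix.one_apply, coeffMatrix]

theorem coeffMatrix_mulVec_of_mem_compl {A : Finset (Fin n)} {V : Op n (Fin 2)}
    (hV : V ∈ localUnitary Aᶜ) :
    ∃ g : Matrix ({i // i ∉ A} → Fin 2) ({i // i ∉ A} → Fin 2) ℂ, g * gᴴ = 1 ∧
      ∀ ψ : State n (Fin 2), coeffMatrix A (V *ᵥ ψ) = coeffMatrix A ψ * g := by
  obtain ⟨g, hg⟩ := hV.2.exists_kronecker_of_disjoint disjoint_compl_left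
  -- The complement indexes the columns, so the local factor acts from the right, through its
  -- transpose.
  refine ⟨gᵀ, ?_, fun ψ => ?_⟩
  · have h1 : g * gᴴ = 1 := by
      apply one_kronecker_unitary (β := {i // i ∈ A} → Fin 2)
      rw [← hg, Matrix.conjTranspose_submatrix, ← submatrix_mul_equiv']
      have := Matrix.mem_unitaryGroup_iff.1 hV.1
      rw [Matrix.star_eq_conjTranspose] at this
      rw [this, Matrix.submatrix_one_equiv]
    have h2 := mul_eq_one_comm.1 h1
    have h3 := congrArg Matrix.transpose h2
    rwa [Matrix.transpose_mul, Matrix.transpose_one] at h3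
  · ext x y
    change ∑ z, V (glue A x y) z * ψ z = _
    rw [← (glueEquiv A (Fin 2)).sum_comp, Fintype.sum_prod_type_right]
    have : ∀ x' y', V (glue A x y) (glue A x' y') = (1 : Matrix _ _ ℂ) x x' * g y y' :=
      fun x' y' => congrFun (congrFun hg (x, y)) (x', y')
    simp [this, Matrix.mul_apply, Matrix.one_apply, coeffMatrix, mul_comm]

end Support

/-! ### Causality of the circuit and normal form of the hand states. -/

section Circuit

variable {n : ℕ} {u : Fin n → Op n (Fin 2)}

/-- The sites `i` with `p ≤ i < r`. -/
def segment (n p r : ℕ) : Finset (Fin n) :=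
  Finset.univ.filter fun i : Fin n => p ≤ (i : ℕ) ∧ (i : ℕ) < r

@[simp] theorem mem_segment {p r : ℕ} {i : Fin n} :
    i ∈ segment n p r ↔ p ≤ (i : ℕ) ∧ (i : ℕ) < r := by simp [segment]

theorem segment_subset {p r p' r' : ℕ} (hp : p' ≤ p) (hr : r ≤ r') :
    segment n p r ⊆ segment n p' r' := by
  intro i; simp only [mem_segment]; omega

theorem segment_disjoint {p r p' r' : ℕ} (h : r ≤ p') :
    Disjoint (segment n p r) (segment n p' r') := by
  rw [Finset.disjoint_left]; intro i; simp only [mem_segment]; omega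

/-- V is the product of the gates u_s, …, u_{t-1}, which together touch the sites s, …, t. -/
theorem exists_propagator_eq_mul [NeZero n]
    (hunitary : ∀ t, u t ∈ Matrix.unitaryGroup (Fin n → Fin 2) ℂ)
    (hlocal : ∀ t, SupportedOn {t, t + 1} (u t)) {s t : ℕ} (hst : s ≤ t) (ht : t < n) :
    ∃ V ∈ localUnitary (segment n s (t + 1)), propagator u t = V * propagator u s := by
  induction t, hst using Nat.le_induction with
  | base => exact ⟨1, one_mem _, (one_mul _).symm⟩
  | succ t hst ih =>
    obtain ⟨V, hV, h⟩ := ih (by omega)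
    have htn : t < n := by omega
    have hu : u ⟨t, htn⟩ ∈ localUnitary (segment n s (t + 1 + 1)) := by
      refine ⟨hunitary _, (hlocal _).mono fun i hi => ?_⟩
      -- The bound t + 1 < n keeps the gate from wrapping around the ring.
      have h1 : ((⟨t, htn⟩ + 1 : Fin n) : ℕ) = t + 1 := by
        rw [Fin.val_add, Fin.val_one', Nat.add_mod_mod, Nat.mod_eq_of_lt ht]
      simp only [Finset.mem_insert, Finset.mem_singleton] at hi
      rw [mem_segment]
      rcases hi with rfl | rfl
      · simp only; omega
      · omega
    refine ⟨u ⟨t, htn⟩ * V, mul_mem hu (localUnitary_mono (segment_subset le_rfl (by omega)) hV), ?_⟩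
    rw [propagator, dif_pos htn, h, mul_assoc]

theorem propagator_mem_localUnitary [NeZero n]
    (hunitary : ∀ t, u t ∈ Matrix.unitaryGroup (Fin n → Fin 2) ℂ)
    (hlocal : ∀ t, SupportedOn {t, t + 1} (u t)) {t : ℕ} (ht : t < n) :
    propagator u t ∈ localUnitary (segment n 0 (t + 1)) := by
  obtain ⟨V, hV, h⟩ := exists_propagator_eq_mul hunitary hlocal (Nat.zero_le t) ht
  rw [h, propagator, mul_one]
  exact hV

/-- The ordered product of the propagators to the positions in a list. -/
def listPropagator (u : Fin n → Op n (Fin 2)) (L : List (Fin n)) : Op n (Fin 2) :=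
  (L.map fun i : Fin n => propagator u (i : ℕ)).prod

theorem listPropagator_mem_localUnitary [NeZero n]
    (hunitary : ∀ t, u t ∈ Matrix.unitaryGroup (Fin n → Fin 2) ℂ)
    (hlocal : ∀ t, SupportedOn {t, t + 1} (u t)) {r : ℕ} {L : List (Fin n)}
    (hL : ∀ i ∈ L, (i : ℕ) < r) : listPropagator u L ∈ localUnitary (segment n 0 r) := by
  refine list_prod_mem fun U hU => ?_
  obtain ⟨i, hi, rfl⟩ := List.mem_map.1 hU
  exact localUnitary_mono (segment_subset le_rfl (hL i hi))
    (propagator_mem_localUnitary hunitary hlocal i.2)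

/-- The product of `m` propagators to the consecutive positions `p, p + 1, …`. -/
def consecutivePropagator (u : Fin n → Op n (Fin 2)) (p m : ℕ) : Op n (Fin 2) :=
  ((List.range m).map fun j => propagator u (p + j)).prod

theorem consecutivePropagator_succ (p m : ℕ) : consecutivePropagator u p (m + 1) =
    consecutivePropagator u p m * propagator u (p + m) := by
  simp [consecutivePropagator, List.range_succ]

theorem consecutivePropagator_mem [NeZero n]
    (hunitary : ∀ t, u t ∈ Matrix.unitaryGroup (Fin n → Fin 2) ℂ)
    (hlocal : ∀ t, SupportedOn {t, t + 1} (u t)) {p m : ℕ} (h : p + m ≤ n) :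
    consecutivePropagator u p m ∈ localUnitary (segment n 0 (p + m)) := by
  refine list_prod_mem fun U hU => ?_
  obtain ⟨i, hi, rfl⟩ := List.mem_map.1 hU
  have := List.mem_range.1 hi
  exact localUnitary_mono (segment_subset le_rfl (by omega))
    (propagator_mem_localUnitary hunitary hlocal (by omega))

/-- Hands inside a segment can be moved to its left end by a unitary on that segment. -/
theorem exists_listPropagator_eq_mul [NeZero n]
    (hunitary : ∀ t, u t ∈ Matrix.unitaryGroup (Fin n → Fin 2) ℂ)
    (hlocal : ∀ t, SupportedOn {t, t + 1} (u t)) {p : ℕ} (L : List (Fin n)) :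
    ∀ r, p ≤ r → L.Pairwise (· < ·) → (∀ i ∈ L, i ∈ segment n p r) →
      p + L.length ≤ r ∧ ∃ V ∈ localUnitary (segment n p r),
        listPropagator u L = V * consecutivePropagator u p L.length := by
  induction L using List.reverseRecOn with
  | nil =>
    intro r hr _ _
    exact ⟨by simpa using hr, 1, one_mem _, by simp [listPropagator, consecutivePropagator]⟩
  | append_singleton L t ih =>
    intro r hr hL hmem
    have ht := mem_segment.1 (hmem t (by simp))
    rw [List.pairwise_append] at hL
    have hlt : ∀ i ∈ L, i < t := fun i hi => hL.2.2 i hi t (by simp)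
    obtain ⟨hlen, V, hV, h⟩ := ih t ht.1 hL.1 fun i hi =>
      mem_segment.2 ⟨(mem_segment.1 (hmem i (by simp [hi]))).1, hlt i hi⟩
    have htn := t.2
    -- The last hand is moved back to p + m, with m the number of earlier hands. The cost W starts
    -- at site p + m, while the consecutive hands before it act below p + m, so W commutes to the
    -- left past them.
    obtain ⟨W, hW, h'⟩ := exists_propagator_eq_mul hunitary hlocal hlen htn
    have hc := consecutivePropagator_mem hunitary hlocal (p := p) (m := L.length) (by omega)
    refine ⟨by simp; omega, V * W, mul_mem
      (localUnitary_mono (segment_subset le_rfl (by omega)) hV)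
      (localUnitary_mono (segment_subset (by omega) (by omega)) hW), ?_⟩
    have e : listPropagator u (L ++ [t]) = listPropagator u L * propagator u t := by
      simp [listPropagator]
    rw [e, List.length_append, List.length_singleton, consecutivePropagator_succ, h, h',
      mul_assoc, ← mul_assoc _ W, localUnitary_commute hc hW (segment_disjoint le_rfl)]
    simp only [mul_assoc]

/-- Hands at the right end of the ring can be removed by a unitary on that end. -/
theorem exists_listPropagator_mulVec_eq [NeZero n]
    (hunitary : ∀ t, u t ∈ Matrix.unitaryGroup (Fin n → Fin 2) ℂ)
    (hlocal : ∀ t, SupportedOn {t, t + 1} (u t)) {φ : State n (Fin 2)} {c : ℂ}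
    (hc : c * star c = 1) (hφ : propagator u (n - 1) *ᵥ φ = c • φ) (L : List (Fin n)) :
    ∀ r, L.Pairwise (· < ·) → (∀ i ∈ L, r ≤ (i : ℕ)) →
      ∃ W ∈ localUnitary (segment n r n), listPropagator u L *ᵥ φ = W *ᵥ φ := by
  induction L with
  | nil =>
    intro r _ _
    exact ⟨1, one_mem _, by simp [listPropagator]⟩
  | cons t L ih =>
    intro r hL hmem
    rw [List.pairwise_cons] at hL
    obtain ⟨W, hW, h⟩ := ih (t + 1) hL.2 fun i hi => hL.1 i hi
    have htn := t.2
    have htr := hmem t (by simp)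
    obtain ⟨V, hV, h'⟩ := exists_propagator_eq_mul hunitary hlocal
      (show (t : ℕ) ≤ n - 1 by omega) (by omega)
    have hVV : Vᴴ * V = 1 := Matrix.mem_unitaryGroup_iff'.1 hV.1
    -- From V U_{t:0} φ = c φ: a hand that acts on the sites up to t is traded for an operator on
    -- the sites from t on.
    have ht : propagator u t *ᵥ φ = (c • Vᴴ) *ᵥ φ := by
      rw [Matrix.smul_mulVec, ← Matrix.mulVec_smul, ← hφ, h', Matrix.mulVec_mulVec, ← mul_assoc,
        hVV, one_mul]
    have hcV := smul_mem_localUnitary (conjTranspose_mem_localUnitary hV) hc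
    refine ⟨W * (c • Vᴴ), mul_mem (localUnitary_mono (segment_subset (by omega) le_rfl) hW)
      (localUnitary_mono (segment_subset (by omega) (by omega)) hcV), ?_⟩
    have e : listPropagator u (t :: L) = propagator u t * listPropagator u L := by
      simp [listPropagator]
    -- The later hands have become W on the sites beyond t, which commutes with U_{t:0}; then
    -- U_{t:0} meets φ directly.
    rw [e, ← Matrix.mulVec_mulVec, h, Matrix.mulVec_mulVec,
      localUnitary_commute (propagator_mem_localUnitary hunitary hlocal htn) hW
        (segment_disjoint le_rfl), ← Matrix.mulVec_mulVec, ht, Matrix.mulVec_mulVec]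

/-- The last gate is a phase, which can be divided out of the Floquet eigenvalue. -/
theorem exists_propagator_sub_one_mulVec [NeZero n]
    (hunitary : ∀ t, u t ∈ Matrix.unitaryGroup (Fin n → Fin 2) ℂ)
    (hlast : ∀ t : Fin n, (t : ℕ) + 1 = n → ∃ c : ℂ, u t = c • (1 : Op n (Fin 2)))
    {φ : State n (Fin 2)} {θ : ℝ}
    (hfloquet : propagator u n *ᵥ φ = Complex.exp (Complex.I * (θ : ℂ)) • φ) :
    ∃ c : ℂ, c * star c = 1 ∧ propagator u (n - 1) *ᵥ φ = c • φ := by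
  have hn : n - 1 + 1 = n := Nat.succ_pred_eq_of_pos (NeZero.pos n)
  have hlt : n - 1 < n := by omega
  obtain ⟨c, hc⟩ := hlast ⟨n - 1, hlt⟩ hn
  have hcc : star c * c = 1 := by
    have := Matrix.mem_unitaryGroup_iff.1 (hunitary ⟨n - 1, hlt⟩)
    rw [hc, star_smul, smul_mul_smul_comm, star_one, one_mul] at this
    have := congrFun (congrFun this 0) 0
    simpa [mul_comm] using this
  have h : propagator u (n - 1 + 1) = c • propagator u (n - 1) := by
    rw [propagator, dif_pos hlt, hc, Matrix.smul_mul, one_mul]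
  rw [hn] at h
  set e := Complex.exp (Complex.I * (θ : ℂ)) with he
  have hee : e * star e = 1 := by
    rw [he, Complex.star_def, ← Complex.exp_conj, ← Complex.exp_add]
    simp
  refine ⟨star c * e, ?_, ?_⟩
  · rw [star_mul', star_star]
    linear_combination (e * star e) * hcc + hee
  · rw [mul_smul, ← hfloquet, h, Matrix.smul_mulVec, smul_smul, hcc, one_smul]

theorem filter_append_filter_of_pairwise (p : ℕ) (L : List (Fin n))
    (hL : L.Pairwise (· < ·)) :
    L = L.filter (fun i : Fin n => (i : ℕ) < p) ++ L.filter (fun i : Fin n => p ≤ (i : ℕ)) := by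
  induction L with
  | nil => rfl
  | cons t L ih =>
    rw [List.pairwise_cons] at hL
    by_cases h : (t : ℕ) < p
    · rw [List.filter_cons_of_pos (by simpa using h), List.filter_cons_of_neg (by simpa using h),
        List.cons_append, ← ih hL.2]
    · have h1 : (t :: L).filter (fun i : Fin n => (i : ℕ) < p) = [] := by
        rw [List.filter_eq_nil_iff]
        intro i hi
        have : t ≤ i := by
          rcases List.mem_cons.1 hi with rfl | hi
          · exact le_rfl
          · exact (hL.1 i hi).le
        have : (t : ℕ) ≤ i := this
        simp only [decide_eq_true_eq]; omega
      have h2 : (t :: L).filter (fun i : Fin n => p ≤ (i : ℕ)) = t :: L := by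
        rw [List.filter_eq_self]
        intro i hi
        have : t ≤ i := by
          rcases List.mem_cons.1 hi with rfl | hi
          · exact le_rfl
          · exact (hL.1 i hi).le
        have : (t : ℕ) ≤ i := this
        simp only [decide_eq_true_eq]; omega
      rw [h1, h2, List.nil_append]

/-- Up to unitaries on the segment and on its complement, the spin state of a configuration of
hands depends only on the number of hands in the segment. -/
theorem exists_local_factorization [NeZero n]
    (hunitary : ∀ t, u t ∈ Matrix.unitaryGroup (Fin n → Fin 2) ℂ)
    (hlocal : ∀ t, SupportedOn {t, t + 1} (u t))
    (hlast : ∀ t : Fin n, (t : ℕ) + 1 = n → ∃ c : ℂ, u t = c • (1 : Op n (Fin 2)))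
    {φ : State n (Fin 2)} {θ : ℝ}
    (hfloquet : propagator u n *ᵥ φ = Complex.exp (Complex.I * (θ : ℂ)) • φ)
    {p r : ℕ} (hpr : p ≤ r) :
    ∃ (V W : List (Fin n) → Op n (Fin 2)) (X : ℕ → State n (Fin 2)),
      (∀ L, V L ∈ localUnitary (segment n p r)) ∧ (∀ L, W L ∈ localUnitary (segment n p r)ᶜ) ∧
      ∀ L : List (Fin n), L.Pairwise (· < ·) → listPropagator u L *ᵥ φ =
        W (L.filter (· ∈ (segment n p r)ᶜ)) *ᵥ V (L.filter (· ∈ segment n p r)) *ᵥ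
          X (L.filter (· ∈ segment n p r)).length := by
  obtain ⟨c, hc, hcφ⟩ := exists_propagator_sub_one_mulVec hunitary hlast hfloquet
  have hV : ∀ L : List (Fin n), ∃ V ∈ localUnitary (segment n p r), L.Pairwise (· < ·) →
      (∀ i ∈ L, i ∈ segment n p r) → p + L.length ≤ r ∧
        listPropagator u L = V * consecutivePropagator u p L.length := by
    intro L
    by_cases h : L.Pairwise (· < ·) ∧ ∀ i ∈ L, i ∈ segment n p r
    · obtain ⟨h0, V, hV, h'⟩ := exists_listPropagator_eq_mul hunitary hlocal L r hpr h.1 h.2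
      exact ⟨V, hV, fun _ _ => ⟨h0, h'⟩⟩
    -- The identity is a filler for irrelevant lists, so that the choice below is local for every
    -- list.
    · exact ⟨1, one_mem _, fun h1 h2 => (h ⟨h1, h2⟩).elim⟩
  have hW : ∀ L : List (Fin n), ∃ W ∈ localUnitary (segment n r n), L.Pairwise (· < ·) →
      (∀ i ∈ L, r ≤ (i : ℕ)) → listPropagator u L *ᵥ φ = W *ᵥ φ := by
    intro L
    by_cases h : L.Pairwise (· < ·) ∧ ∀ i ∈ L, r ≤ (i : ℕ)
    · obtain ⟨W, hW, h'⟩ := exists_listPropagator_mulVec_eq hunitary hlocal hc hcφ L r h.1 h.2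
      exact ⟨W, hW, fun _ _ => h'⟩
    · exact ⟨1, one_mem _, fun h1 h2 => (h ⟨h1, h2⟩).elim⟩
  choose V hV hV' using hV
  choose W hW hW' using hW
  -- The complement carries the hands left of p, unchanged, and the W that replaces those from r on;
  -- the common state has its m hands at p, …, p + m - 1.
  refine ⟨V, fun L => listPropagator u (L.filter fun i : Fin n => (i : ℕ) < p) *
    W (L.filter fun i : Fin n => r ≤ (i : ℕ)), fun m => consecutivePropagator u p m *ᵥ φ, hV,
    fun L => mul_mem (localUnitary_mono (fun i => ?_) (listPropagator_mem_localUnitary hunitary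
      hlocal (r := p) fun i hi => by simpa using (List.mem_filter.1 hi).2))
      (localUnitary_mono (fun i => ?_) (hW _)), fun L hL => ?_⟩
  · simp only [Finset.mem_compl, mem_segment]; omega
  · simp only [Finset.mem_compl, mem_segment]; omega
  · have e1 : (L.filter (· ∈ (segment n p r)ᶜ)).filter (fun i : Fin n => (i : ℕ) < p) =
        L.filter fun i : Fin n => (i : ℕ) < p := by
      rw [List.filter_filter]
      refine List.filter_congr fun i _ => ?_
      rw [← Bool.decide_and, decide_eq_decide, Finset.mem_compl, mem_segment]; omega
    have e2 : (L.filter (· ∈ (segment n p r)ᶜ)).filter (fun i : Fin n => r ≤ (i : ℕ)) =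
        L.filter fun i : Fin n => r ≤ (i : ℕ) := by
      rw [List.filter_filter]
      refine List.filter_congr fun i _ => ?_
      rw [← Bool.decide_and, decide_eq_decide, Finset.mem_compl, mem_segment]; omega
    have e3 : (L.filter fun i : Fin n => p ≤ (i : ℕ)) =
        L.filter (· ∈ segment n p r) ++ L.filter fun i : Fin n => r ≤ (i : ℕ) := by
      conv_lhs => rw [filter_append_filter_of_pairwise r _ (hL.filter _)]
      rw [List.filter_filter, List.filter_filter]
      congr 1 <;> refine List.filter_congr fun i _ => ?_
      all_goals rw [← Bool.decide_and, decide_eq_decide]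
      · rw [mem_segment]; omega
      · omega
    simp only [e1, e2]
    have hmul : ∀ L L' : List (Fin n), listPropagator u (L ++ L') =
        listPropagator u L * listPropagator u L' := by simp [listPropagator]
    obtain ⟨hlen, hmid⟩ := hV' (L.filter (· ∈ segment n p r)) (hL.filter _)
      fun i hi => by simpa using (List.mem_filter.1 hi).2
    have hright := hW' (L.filter fun i : Fin n => r ≤ (i : ℕ)) (hL.filter _)
      fun i hi => by simpa using (List.mem_filter.1 hi).2
    have hmem : listPropagator u (L.filter (· ∈ segment n p r)) ∈ localUnitary (segment n 0 r) :=
      listPropagator_mem_localUnitary hunitary hlocal fun i hi => by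
        have := (List.mem_filter.1 hi).2
        simp only [mem_segment, decide_eq_true_eq] at this
        exact this.2
    conv_lhs => rw [filter_append_filter_of_pairwise p L hL, e3, hmul, hmul]
    -- The right hands are replaced first, while they act on φ; the result then commutes past the
    -- middle hands, which act below r.
    rw [← Matrix.mulVec_mulVec, ← Matrix.mulVec_mulVec, hright, Matrix.mulVec_mulVec φ,
      localUnitary_commute hmem (hW _) (segment_disjoint le_rfl), hmid]
    simp only [Matrix.mulVec_mulVec, mul_assoc]

end Circuit

/-! ### Anticommutation, Slater determinants and occupation numbers. -/

section Fermions

variable {n : ℕ}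

/-- The occupation number basis state with occupation numbers `y`. -/
def occState (y : Fin n → Bool) : State n Bool := Pi.single y 1

theorem create_mulVec_occState (j : Fin n) (y : Fin n → Bool) :
    create j *ᵥ occState y = if y j = false then
      (-1 : ℂ) ^ (Finset.univ.filter fun i => i < j ∧ y i = true).card •
        occState (Function.update y j true) else 0 := by
  ext x
  rw [occState, Matrix.mulVec_single_one, Matrix.col_apply, create]
  by_cases h : y j = false
  · by_cases hx : x = Function.update y j true
    · simp [h, hx, occState]
    · simp [h, hx, occState]
  · simp [h]

theorem op_ext_occState {O P : Op n Bool} (h : ∀ y, O *ᵥ occState y = P *ᵥ occState y) :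
    O = P := by
  ext x y
  have := congrFun (h y) x
  rwa [occState, Matrix.mulVec_single_one, Matrix.mulVec_single_one] at this

theorem create_mul_create_of_lt {i j : Fin n} (hij : i < j) :
    create i * create j + create j * create i = 0 := by
  refine op_ext_occState fun y => ?_
  have hne : i ≠ j := hij.ne
  rw [Matrix.add_mulVec, ← Matrix.mulVec_mulVec, ← Matrix.mulVec_mulVec, Matrix.zero_mulVec,
    create_mulVec_occState, create_mulVec_occState]
  by_cases hi : y i = false
  · by_cases hj : y j = false
    · rw [if_pos hi, if_pos hj, Matrix.mulVec_smul, Matrix.mulVec_smul, create_mulVec_occState,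
        create_mulVec_occState, Function.update_of_ne hne, Function.update_of_ne hne.symm,
        if_pos hi, if_pos hj, Function.update_comm hne]
      have h1 : (Finset.univ.filter fun k => k < i ∧ Function.update y j true k = true) =
          Finset.univ.filter fun k => k < i ∧ y k = true := by
        refine Finset.filter_congr fun k _ => and_congr_right fun hk => ?_
        rw [Function.update_of_ne (hk.trans hij).ne]
      -- Only the creation at the larger site j sees the other fermion; this one extra sign is the
      -- anticommutation.
      have h2 : (Finset.univ.filter fun k => k < j ∧ Function.update y i true k = true) =
          insert i (Finset.univ.filter fun k => k < j ∧ y k = true) := by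
        ext k
        by_cases hk : k = i
        · subst hk; simp [hij]
        · simp [hk]
      rw [h1, h2, Finset.card_insert_of_notMem (by simp [hi]), pow_succ, smul_smul, smul_smul,
        ← add_smul]
      ring_nf
      exact zero_smul _ _
    · simp [hj, hi, create_mulVec_occState, Function.update_of_ne hne.symm, Matrix.mulVec_smul]
  · simp only [hi, if_false, Matrix.mulVec_zero, add_zero, Bool.true_eq_false]
    split_ifs
    · simp [create_mulVec_occState, Function.update_of_ne hne, Matrix.mulVec_smul, hi]
    · simp

theorem create_mul_self (i : Fin n) : create i * create i = 0 := by
  refine op_ext_occState fun y => ?_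
  rw [← Matrix.mulVec_mulVec, create_mulVec_occState]
  split_ifs
  · simp [create_mulVec_occState, Matrix.mulVec_smul]
  · simp

theorem create_mul_create (i j : Fin n) : create i * create j = -(create j * create i) := by
  rcases lt_trichotomy i j with h | rfl | h
  · exact eq_neg_of_add_eq_zero_left (create_mul_create_of_lt h)
  · rw [create_mul_self, neg_zero]
  · exact eq_neg_of_add_eq_zero_right (create_mul_create_of_lt h)

/-- The creation operator of a fermion with wave function `f`. -/
def createMode (n : ℕ) : (Fin n → ℂ) →ₗ[ℂ] Op n Bool :=
  Fintype.linearCombination ℂ create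

theorem createMode_apply (f : Fin n → ℂ) : createMode n f = ∑ t, f t • create t := rfl

theorem createMode_single (t : Fin n) : createMode n (Pi.single t 1) = create t := by
  simp [createMode]

/-- This is the relation needed to extend `createMode` to the exterior algebra, which makes
`createMulti` alternating. -/
theorem createMode_mul_self (f : Fin n → ℂ) : createMode n f * createMode n f = 0 := by
  have h : createMode n f * createMode n f = -(createMode n f * createMode n f) := by
    rw [createMode_apply, Finset.sum_mul_sum]
    conv_rhs => rw [Finset.sum_comm]
    simp only [← Finset.sum_neg_distrib]
    refine Finset.sum_congr rfl fun i _ => Finset.sum_congr rfl fun j _ => ?_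
    rw [smul_mul_smul_comm, smul_mul_smul_comm, create_mul_create i j, smul_neg, mul_comm (f i)]
  ext x y
  exact self_eq_neg.1 (congrFun (congrFun h x) y)

/-- The product of creation operators as an alternating map of the wave functions. -/
def createMulti (n M : ℕ) : (Fin n → ℂ) [⋀^Fin M]→ₗ[ℂ] Op n Bool :=
  (ExteriorAlgebra.lift ℂ ⟨createMode n, createMode_mul_self⟩).toLinearMap.compAlternatingMap
    (ExteriorAlgebra.ιMulti ℂ M)

theorem createMulti_apply {M : ℕ} (v : Fin M → Fin n → ℂ) :
    createMulti n M v = (List.ofFn fun j => createMode n (v j)).prod := by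
  simp [createMulti, ExteriorAlgebra.ιMulti_apply, map_list_prod, List.map_ofFn,
    Function.comp_def]

theorem handCreate_eq_createMulti {M : ℕ} (t : HandConfig n M) :
    handCreate t = createMulti n M fun j => Pi.single (t.1 j) 1 := by
  simp only [createMulti_apply, createMode_single, handCreate]

/-- Every injective map from `Fin M` is a strictly monotone map composed with a permutation. -/
theorem exists_comp_perm_of_injective {M : ℕ} {r : Fin M → Fin n} (hr : Function.Injective r) :
    ∃ (t : HandConfig n M) (σ : Equiv.Perm (Fin M)), t.1 ∘ σ = r :=
  ⟨⟨r ∘ Tuple.sort r, (Tuple.monotone_sort r).strictMono_of_injective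
    (hr.comp (Tuple.sort r).injective)⟩, (Tuple.sort r)⁻¹, by ext j; simp⟩

/-- The range determines the increasing map, whose injectivity then determines the permutation. -/
theorem comp_perm_injective {M : ℕ} : Function.Injective
    fun p : HandConfig n M × Equiv.Perm (Fin M) => p.1.1 ∘ p.2 := by
  rintro ⟨t, σ⟩ ⟨t', σ'⟩ h
  have h0 : t.1 ∘ σ = t'.1 ∘ σ' := h
  have hr : Set.range t.1 = Set.range t'.1 := by
    rw [← σ.surjective.range_comp t.1, h0, σ'.surjective.range_comp]
  have ht : t = t' := Subtype.ext ((StrictMono.range_inj t.2 t'.2).1 hr)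
  subst ht
  have hσ : σ = σ' := by
    ext j
    exact congrArg _ (t.2.injective (congrFun h0 j))
  rw [hσ]

theorem createMulti_eq_sum {M : ℕ} (v : Fin M → Fin n → ℂ) :
    createMulti n M v = ∑ t : HandConfig n M, (∑ σ : Equiv.Perm (Fin M),
      ((Equiv.Perm.sign σ : ℤ) : ℂ) * ∏ j, v j (t.1 (σ j))) • handCreate t := by
  have h1 : createMulti n M v =
      ∑ r : Fin M → Fin n, (∏ j, v j (r j)) • createMulti n M fun j => Pi.single (r j) 1 := by
    have hv : v = fun j => ∑ t, v j t • (Pi.single t 1 : Fin n → ℂ) := by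
      funext j; exact pi_eq_sum_univ' (v j)
    conv_lhs => rw [hv]
    rw [← AlternatingMap.coe_multilinearMap, MultilinearMap.map_sum]
    refine Finset.sum_congr rfl fun r _ => ?_
    rw [MultilinearMap.map_smul_univ]
  rw [h1]
  simp only [Finset.sum_smul]
  rw [← Fintype.sum_prod_type']
  symm
  -- Position maps not of the form t ∘ σ are not injective and are killed by alternation; the others
  -- contribute the sign of σ.
  refine Fintype.sum_of_injective _ comp_perm_injective _ _ (fun r hr => ?_) fun p => ?_
  · rw [AlternatingMap.map_eq_zero_of_not_injective, smul_zero]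
    intro hinj
    have hr' : Function.Injective r := fun i j hij => hinj (by simp only [hij])
    obtain ⟨t, σ, h⟩ := exists_comp_perm_of_injective hr'
    exact hr ⟨(t, σ), h⟩
  · have := (createMulti n M).map_perm (fun j => Pi.single (p.1.1 j) 1) p.2
    simp only [Function.comp_def] at this ⊢
    rw [this, handCreate_eq_createMulti, mul_comm, mul_smul]
    congr 1
    rw [Units.smul_def, Int.cast_smul_eq_zsmul]

theorem slaterCreate_eq_prod {M : ℕ} (q : Fin M → Fin n) (θ : ℝ) :
    slaterCreate q θ = (List.ofFn fun j => planeWaveCreate (q j) θ).prod := by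
  have h : ∀ j, planeWaveCreate (q j) θ = createMode n fun t => ((Real.sqrt n : ℝ) : ℂ)⁻¹ *
      Complex.exp (Complex.I * ((twistedMomentum θ (q j) * ((t : ℕ) : ℝ) : ℝ) : ℂ)) := by
    intro j
    rw [planeWaveCreate, createMode_apply, Finset.smul_sum]
    simp only [smul_smul]
  simp only [h]
  rw [← createMulti_apply, createMulti_eq_sum, slaterCreate]
  refine Finset.sum_congr rfl fun t _ => ?_
  congr 1
  rw [slaterCoeff, Finset.mul_sum]
  refine Finset.sum_congr rfl fun σ _ => ?_
  rw [Finset.prod_mul_distrib, ← Complex.exp_sum, Finset.prod_const, Finset.card_univ,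
    Fintype.card_fin, Finset.mul_sum]
  ring

/-- The occupation numbers of a configuration of hands. -/
def occ {M : ℕ} (t : HandConfig n M) : Fin n → Bool := fun i => decide (∃ j, t.1 j = i)

/-- The increasing list of the occupied sites. -/
def occList (y : Fin n → Bool) : List (Fin n) := (List.finRange n).filter fun i => y i

theorem occList_pairwise (y : Fin n → Bool) : (occList y).Pairwise (· < ·) :=
  (List.pairwise_lt_finRange n).filter _

@[simp] theorem mem_occList {y : Fin n → Bool} {i : Fin n} : i ∈ occList y ↔ y i = true := by
  simp [occList]

theorem occList_occ {M : ℕ} (t : HandConfig n M) : occList (occ t) = List.ofFn t.1 := by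
  refine (occList_pairwise _).eq_of_mem_iff (List.pairwise_ofFn.2 fun i j h => t.2 h) fun i => ?_
  simp [occ, List.mem_ofFn]

theorem occ_injective {M : ℕ} : Function.Injective (occ : HandConfig n M → _) := by
  intro t t' h
  have := congrArg occList h
  rw [occList_occ, occList_occ] at this
  exact Subtype.ext (List.ofFn_injective this)

/-- No sign appears: each fermion is created to the left of all those already present. -/
theorem prod_create_mulVec_vacuum (L : List (Fin n)) (hL : L.Pairwise (· < ·)) :
    (L.map create).prod *ᵥ vacuum n = occState fun i => decide (i ∈ L) := by
  induction L with
  | nil =>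
    ext x
    simp [vacuum, occState, Pi.single_apply, funext_iff]
  | cons t L ih =>
    rw [List.pairwise_cons] at hL
    have ht : t ∉ L := fun h => lt_irrefl _ (hL.1 t h)
    rw [List.map_cons, List.prod_cons, ← Matrix.mulVec_mulVec, ih hL.2, create_mulVec_occState,
      if_pos (by simpa using ht)]
    have : (Finset.univ.filter fun i => i < t ∧ decide (i ∈ L) = true) = ∅ := by
      rw [Finset.filter_eq_empty_iff]
      rintro i - ⟨h1, h2⟩
      exact lt_asymm h1 (hL.1 i (by simpa using h2))
    rw [this, Finset.card_empty, pow_zero, one_smul]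
    congr 1
    funext i
    by_cases h : i = t
    · subst h; simp
    · simp [h]

theorem handCreate_mulVec_vacuum {M : ℕ} (t : HandConfig n M) :
    handCreate t *ᵥ vacuum n = occState (occ t) := by
  have h : handCreate t = ((List.ofFn t.1).map create).prod := by
    rw [List.map_ofFn]; rfl
  rw [h, prod_create_mulVec_vacuum _ (List.pairwise_ofFn.2 fun i j h => t.2 h)]
  congr 1
  funext i
  simp [occ, List.mem_ofFn]

theorem slaterCreate_mulVec_vacuum {M : ℕ} (q : Fin M → Fin n) (θ : ℝ) :
    slaterCreate q θ *ᵥ vacuum n = ∑ t, slaterCoeff q θ t • occState (occ t) := by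
  simp only [slaterCreate, Matrix.sum_mulVec, Matrix.smul_mulVec, handCreate_mulVec_vacuum]

theorem slaterCreate_mulVec_vacuum_occ {M : ℕ} (q : Fin M → Fin n) (θ : ℝ) (t : HandConfig n M) :
    (slaterCreate q θ *ᵥ vacuum n) (occ t) = slaterCoeff q θ t := by
  rw [slaterCreate_mulVec_vacuum]
  simp [occState, Pi.single_apply, occ_injective.eq_iff]

theorem exists_occ_eq_of_ne_zero {M : ℕ} (q : Fin M → Fin n) (θ : ℝ) {y : Fin n → Bool}
    (h : (slaterCreate q θ *ᵥ vacuum n) y ≠ 0) : ∃ t : HandConfig n M, occ t = y := by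
  by_contra! H
  apply h
  rw [slaterCreate_mulVec_vacuum]
  simp [occState, fun t => (H t).symm]

theorem exp_twistedMomentum_injective [NeZero n] (θ : ℝ) : Function.Injective fun q : Fin n =>
    Complex.exp (Complex.I * (twistedMomentum θ q : ℂ)) := by
  intro q q' h
  obtain ⟨k, hk⟩ := Complex.exp_eq_exp_iff_exists_int.1 h
  have hn : (n : ℝ) ≠ 0 := Nat.cast_ne_zero.2 (NeZero.ne n)
  have h1 : twistedMomentum θ q = twistedMomentum θ q' + k * (2 * Real.pi) := by
    have : Complex.I * (twistedMomentum θ q : ℂ) =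
        Complex.I * ((twistedMomentum θ q' + k * (2 * Real.pi) : ℝ) : ℂ) := by
      rw [hk]; push_cast; ring
    exact_mod_cast mul_left_cancel₀ Complex.I_ne_zero this
  have h2 : ((q : ℕ) : ℝ) = (q' : ℕ) + k * n := by
    unfold twistedMomentum at h1
    field_simp at h1
    have hpi := Real.pi_pos
    have : (2 * Real.pi) * ((q : ℕ) : ℝ) = (2 * Real.pi) * ((q' : ℕ) + k * n) := by linarith
    exact mul_left_cancel₀ (by positivity) this
  have h3 : ((q : ℕ) : ℤ) = (q' : ℕ) + k * n := by exact_mod_cast h2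
  have h4 := q.2
  have h5 := q'.2
  -- Both momentum labels lie in [0, n), so they cannot differ by a nonzero multiple of n.
  have hk0 : k = 0 := by
    rcases lt_trichotomy k 0 with hk | hk | hk
    · nlinarith
    · exact hk
    · nlinarith
  rw [hk0] at h3
  exact Fin.ext (by omega)

/-- With the hands at 0, …, M - 1 the coefficient is a nonzero multiple of a Vandermonde determinant
with distinct nodes. This makes the clock state nonzero, so that its purity has a genuine logarithm.
-/
theorem exists_slaterCoeff_ne_zero [NeZero n] {M : ℕ} {q : Fin M → Fin n}
    (hq : Function.Injective q) (θ : ℝ) : ∃ t : HandConfig n M, slaterCoeff q θ t ≠ 0 := by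
  have hM : M ≤ n := by simpa using Fintype.card_le_of_injective q hq
  refine ⟨⟨Fin.castLE hM, Fin.strictMono_castLE hM⟩, ?_⟩
  have hn : ((Real.sqrt n : ℝ) : ℂ) ≠ 0 := by
    rw [Ne, Complex.ofReal_eq_zero, Real.sqrt_eq_zero (Nat.cast_nonneg n)]
    exact Nat.cast_ne_zero.2 (NeZero.ne n)
  refine mul_ne_zero (pow_ne_zero _ (inv_ne_zero hn)) ?_
  have hdet := Matrix.det_vandermonde_ne_zero_iff.2 ((exp_twistedMomentum_injective θ).comp hq)
  rw [← Matrix.det_transpose, Matrix.det_apply'] at hdet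
  convert hdet using 4 with σ
  rw [Finset.mul_sum, Complex.exp_sum]
  refine Finset.prod_congr rfl fun j _ => ?_
  rw [Matrix.transpose_apply, Matrix.vandermonde_apply, Function.comp_apply, ← Complex.exp_nat_mul]
  congr 1
  push_cast [Fin.val_castLE]
  ring

end Fermions

/-! ### Purities, their local invariance and the block structure of the ladder. -/

section Purity

variable {n : ℕ}

/-- The sum of the squared moduli of the entries of a matrix. -/
def frobeniusSq {α β : Type} [Fintype α] [Fintype β] (N : Matrix α β ℂ) : ℝ :=
  ∑ x, ∑ y, Complex.normSq (N x y)

theorem trace_mul_conjTranspose_eq {α β : Type} [Fintype α] [Fintype β] (N : Matrix α β ℂ) :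
    Matrix.trace (N * Nᴴ) = (frobeniusSq N : ℂ) := by
  simp [Matrix.trace, Matrix.mul_apply, frobeniusSq, Complex.mul_conj]

/-- Two different unitaries are allowed because off-diagonal clock blocks carry different ones on
the two sides. -/
theorem frobeniusSq_unitary_mul {α : Type} [Fintype α] [DecidableEq α] {g h : Matrix α α ℂ}
    (hg : g * gᴴ = 1) (hh : h * hᴴ = 1) (N : Matrix α α ℂ) :
    frobeniusSq (g * N * hᴴ) = frobeniusSq N := by
  have hg' := mul_eq_one_comm.1 hg
  have hh' := mul_eq_one_comm.1 hh
  have : (frobeniusSq (g * N * hᴴ) : ℂ) = frobeniusSq N := by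
    rw [← trace_mul_conjTranspose_eq, ← trace_mul_conjTranspose_eq, Matrix.conjTranspose_mul,
      Matrix.conjTranspose_mul, Matrix.conjTranspose_conjTranspose]
    have e : g * N * hᴴ * (h * (Nᴴ * gᴴ)) = g * (N * Nᴴ * gᴴ) := by
      calc g * N * hᴴ * (h * (Nᴴ * gᴴ)) = g * N * (hᴴ * h) * (Nᴴ * gᴴ) := by
            simp only [mul_assoc]
        _ = g * (N * Nᴴ * gᴴ) := by rw [hh', mul_one]; simp only [mul_assoc]
    rw [e, Matrix.trace_mul_comm, mul_assoc, hg', mul_one]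
  exact_mod_cast this

theorem reducedDensity_eq_mul {κ : Type} [Fintype κ] (A : Finset (Fin n)) (ψ : State n κ) :
    reducedDensity A ψ = coeffMatrix A ψ * (coeffMatrix A ψ)ᴴ := rfl

/-- The purity of the reduced density matrix. -/
def purity {κ : Type} [Fintype κ] (A : Finset (Fin n)) (ψ : State n κ) : ℝ :=
  frobeniusSq (reducedDensity A ψ)

theorem renyi2_eq {κ : Type} [Fintype κ] (A : Finset (Fin n)) (ψ : State n κ) :
    renyi2 A ψ = -Real.log (purity A ψ) := by
  have h : (reducedDensity A ψ)ᴴ = reducedDensity A ψ := by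
    rw [reducedDensity_eq_mul, Matrix.conjTranspose_mul, Matrix.conjTranspose_conjTranspose]
  have h' := trace_mul_conjTranspose_eq (reducedDensity A ψ)
  rw [h] at h'
  rw [renyi2, h', Complex.ofReal_re, purity]

theorem reducedDensity_self_ne_zero {κ : Type} [Fintype κ] {A : Finset (Fin n)} {ψ : State n κ}
    {x : {i // i ∈ A} → κ} {y : {i // i ∉ A} → κ} (h : ψ (glue A x y) ≠ 0) :
    reducedDensity A ψ x x ≠ 0 := by
  have : reducedDensity A ψ x x =
      ((∑ y : {i // i ∉ A} → κ, Complex.normSq (ψ (glue A x y)) : ℝ) : ℂ) := by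
    simp [reducedDensity, Complex.mul_conj]
  rw [this, Complex.ofReal_ne_zero]
  exact ne_of_gt (Finset.sum_pos' (fun _ _ => Complex.normSq_nonneg _)
    ⟨y, Finset.mem_univ _, by exact Complex.normSq_pos.2 h⟩)

theorem exists_ne_zero_of_reducedDensity_ne_zero {κ : Type} [Fintype κ] {A : Finset (Fin n)}
    {ψ : State n κ} {x x' : {i // i ∈ A} → κ} (h : reducedDensity A ψ x x' ≠ 0) :
    ∃ y, ψ (glue A x y) ≠ 0 ∧ ψ (glue A x' y) ≠ 0 := by
  obtain ⟨y, -, hy⟩ := Finset.exists_ne_zero_of_sum_ne_zero h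
  exact ⟨y, left_ne_zero_of_mul hy, fun H => right_ne_zero_of_mul hy (by rw [H, star_zero])⟩

theorem purity_pos {κ : Type} [Fintype κ] (A : Finset (Fin n)) {ψ : State n κ} (h : ψ ≠ 0) :
    0 < purity A ψ := by
  obtain ⟨z, hz⟩ := Function.ne_iff.1 h
  obtain ⟨⟨x, y⟩, rfl⟩ := (glueEquiv A κ).surjective z
  refine Finset.sum_pos' (fun _ _ => Finset.sum_nonneg fun _ _ => Complex.normSq_nonneg _)
    ⟨x, Finset.mem_univ _, Finset.sum_pos' (fun _ _ => Complex.normSq_nonneg _)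
      ⟨x, Finset.mem_univ _, Complex.normSq_pos.2 (reducedDensity_self_ne_zero hz)⟩⟩

theorem purity_local_unitary {A : Finset (Fin n)} {V W : Op n (Fin 2)} (hV : V ∈ localUnitary A)
    (hW : W ∈ localUnitary Aᶜ) (ψ : State n (Fin 2)) :
    purity A (V *ᵥ W *ᵥ ψ) = purity A ψ := by
  obtain ⟨g, hg, hg'⟩ := coeffMatrix_mulVec_of_mem hV
  obtain ⟨h, hh, hh'⟩ := coeffMatrix_mulVec_of_mem_compl hW
  rw [purity, reducedDensity_eq_mul, hg', hh', purity, reducedDensity_eq_mul,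
    ← frobeniusSq_unitary_mul hg hg (coeffMatrix A ψ * (coeffMatrix A ψ)ᴴ),
    Matrix.conjTranspose_mul, Matrix.conjTranspose_mul]
  congr 1
  calc g * (coeffMatrix A ψ * h) * (hᴴ * (coeffMatrix A ψ)ᴴ * gᴴ)
      = g * (coeffMatrix A ψ * (h * hᴴ) * (coeffMatrix A ψ)ᴴ) * gᴴ := by
        simp only [Matrix.mul_assoc]
    _ = _ := by rw [hh, Matrix.mul_one]

theorem glue_fst (A : Finset (Fin n)) (x : {i // i ∈ A} → Fin 2 × Bool)
    (y : {i // i ∉ A} → Fin 2 × Bool) :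
    (fun i => (glue A x y i).1) = glue A (fun i => (x i).1) fun i => (y i).1 := by
  funext i; unfold glue; split_ifs <;> rfl

theorem glue_snd (A : Finset (Fin n)) (x : {i // i ∈ A} → Fin 2 × Bool)
    (y : {i // i ∉ A} → Fin 2 × Bool) :
    (fun i => (glue A x y i).2) = glue A (fun i => (x i).2) fun i => (y i).2 := by
  funext i; unfold glue; split_ifs <;> rfl

/-- The purity of a ladder state whose spin state is controlled by the clock, when the controlled
spin states agree up to local unitaries. -/
theorem purity_ladder {A : Finset (Fin n)} {C : State n Bool}
    {σ : (Fin n → Bool) → State n (Fin 2)} {Ψ : State n (Fin 2 × Bool)}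
    (hΨ : ∀ x, Ψ x = C (fun i => (x i).2) * σ (fun i => (x i).2) fun i => (x i).1)
    {V : ({i // i ∈ A} → Bool) → Op n (Fin 2)} {W : ({i // i ∉ A} → Bool) → Op n (Fin 2)}
    {X : ({i // i ∈ A} → Bool) → State n (Fin 2)}
    (hV : ∀ a, V a ∈ localUnitary A) (hW : ∀ b, W b ∈ localUnitary Aᶜ)
    (hX : ∀ a a' b, C (glue A a b) ≠ 0 → C (glue A a' b) ≠ 0 → X a = X a')
    (hσ : ∀ a b, C (glue A a b) ≠ 0 → σ (glue A a b) = V a *ᵥ W b *ᵥ X a) :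
    purity A Ψ = ∑ a, ∑ a', Complex.normSq (reducedDensity A C a a') * purity A (X a) := by
  choose g hg hg' using fun a => coeffMatrix_mulVec_of_mem (hV a)
  choose h hh hh' using fun b => coeffMatrix_mulVec_of_mem_compl (hW b)
  have key : ∀ x x' : {i // i ∈ A} → Fin 2 × Bool, reducedDensity A Ψ x x' =
      reducedDensity A C (fun i => (x i).2) (fun i => (x' i).2) *
        (g (fun i => (x i).2) * reducedDensity A (X fun i => (x i).2) *
          (g fun i => (x' i).2)ᴴ) (fun i => (x i).1) fun i => (x' i).1 := by
    intro x x'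
    rw [reducedDensity, reducedDensity, Finset.sum_mul,
      ← (Equiv.arrowProdEquivProdArrow _ _ _).symm.sum_comp, Fintype.sum_prod_type_right]
    refine Finset.sum_congr rfl fun b _ => ?_
    simp only [hΨ, glue_fst, glue_snd]
    set a := fun i => (x i).2
    set a' := fun i => (x' i).2
    change ∑ y, C (glue A a b) * σ (glue A a b) (glue A _ y) *
      star (C (glue A a' b) * σ (glue A a' b) (glue A _ y)) = _
    by_cases h1 : C (glue A a b) = 0
    · simp [h1]
    by_cases h2 : C (glue A a' b) = 0
    · simp [h2]
    -- Both spin states carry the same unitary off `A`, which cancels in the partial trace; what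
    -- remains no longer depends on b, so the sum over b rebuilds the clock entry.
    have e : coeffMatrix A (σ (glue A a b)) * (coeffMatrix A (σ (glue A a' b)))ᴴ =
        g a * reducedDensity A (X a) * (g a')ᴴ := by
      rw [hσ a b h1, hσ a' b h2, hg', hg', hh', hh', ← hX a a' b h1 h2, reducedDensity_eq_mul,
        Matrix.conjTranspose_mul, Matrix.conjTranspose_mul]
      calc g a * (coeffMatrix A (X a) * h b) * ((h b)ᴴ * (coeffMatrix A (X a))ᴴ * (g a')ᴴ)
          = g a * (coeffMatrix A (X a) * (h b * (h b)ᴴ) * (coeffMatrix A (X a))ᴴ) * (g a')ᴴ := by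
            simp only [Matrix.mul_assoc]
        _ = _ := by rw [hh, Matrix.mul_one]
    rw [← e, Matrix.mul_apply, Finset.mul_sum]
    refine Finset.sum_congr rfl fun y _ => ?_
    rw [star_mul', Matrix.conjTranspose_apply, coeffMatrix, coeffMatrix]
    ring
  rw [purity, frobeniusSq]
  simp only [key, Complex.normSq_mul]
  rw [← (Equiv.arrowProdEquivProdArrow _ _ _).symm.sum_comp, Fintype.sum_prod_type_right]
  refine Finset.sum_congr rfl fun a _ => ?_
  simp only [← (Equiv.arrowProdEquivProdArrow {i // i ∈ A} (fun _ => Fin 2) fun _ => Bool).symm.sum_comp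
    (fun x' => Complex.normSq (reducedDensity A C _ _) * Complex.normSq _),
    Fintype.sum_prod_type_right]
  rw [Finset.sum_comm]
  refine Finset.sum_congr rfl fun a' _ => ?_
  rw [purity, ← frobeniusSq_unitary_mul (hg a) (hg a'), frobeniusSq, Finset.mul_sum]
  refine Finset.sum_congr rfl fun s _ => ?_
  rw [Finset.mul_sum]
  rfl

/-- If the spin states controlled by the clock agree up to local unitaries and their purity is
at most `P`, then the purity of the ladder state is at most `P` times that of the clock. -/
theorem purity_ladder_pos_and_le {A : Finset (Fin n)} {C : State n Bool}
    {σ : (Fin n → Bool) → State n (Fin 2)} {Ψ : State n (Fin 2 × Bool)}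
    (hΨ : ∀ x, Ψ x = C (fun i => (x i).2) * σ (fun i => (x i).2) fun i => (x i).1)
    {V : ({i // i ∈ A} → Bool) → Op n (Fin 2)} {W : ({i // i ∉ A} → Bool) → Op n (Fin 2)}
    {X : ({i // i ∈ A} → Bool) → State n (Fin 2)}
    (hV : ∀ a, V a ∈ localUnitary A) (hW : ∀ b, W b ∈ localUnitary Aᶜ)
    (hX : ∀ a a' b, C (glue A a b) ≠ 0 → C (glue A a' b) ≠ 0 → X a = X a')
    (hσ : ∀ a b, C (glue A a b) ≠ 0 → σ (glue A a b) = V a *ᵥ W b *ᵥ X a)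
    (hC : C ≠ 0) (hne : ∀ y, C y ≠ 0 → σ y ≠ 0) {P : ℝ}
    (hP : ∀ y, C y ≠ 0 → purity A (σ y) ≤ P) :
    0 < purity A Ψ ∧ purity A Ψ ≤ purity A C * P := by
  constructor
  · obtain ⟨y, hy⟩ := Function.ne_iff.1 hC
    have hs := hne y hy
    obtain ⟨z, hz⟩ := Function.ne_iff.1 hs
    refine purity_pos A fun H => mul_ne_zero hy hz ?_
    have := hΨ fun i => (z i, y i)
    rw [H] at this
    exact this.symm
  · rw [purity_ladder hΨ hV hW hX hσ, purity, frobeniusSq, Finset.sum_mul]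
    refine Finset.sum_le_sum fun a _ => ?_
    rw [Finset.sum_mul]
    refine Finset.sum_le_sum fun a' _ => ?_
    -- A nonzero entry supplies some b at which (a, b) has nonzero amplitude; there X_a has the
    -- purity of an actual spin state.
    by_cases h : reducedDensity A C a a' = 0
    · simp [h]
    · obtain ⟨b, hb, -⟩ := exists_ne_zero_of_reducedDensity_ne_zero h
      refine mul_le_mul_of_nonneg_left ?_ (Complex.normSq_nonneg _)
      rw [← purity_local_unitary (hV a) (hW b), ← hσ a b hb]
      exact hP _ hb

end Purity

/-! ### Ring intervals and the entropy bound. -/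

section Ladder

variable {n : ℕ}

theorem ringInterval_eq_segment_or_compl (a : Fin n) {ℓ : ℕ} (hℓ : ℓ ≤ n) :
    ∃ p r, p ≤ r ∧
      (ringInterval a ℓ = segment n p r ∨ ringInterval a ℓ = (segment n p r)ᶜ) := by
  have ha := a.2
  by_cases h : (a : ℕ) + ℓ ≤ n
  · refine ⟨a, a + ℓ, by omega, Or.inl ?_⟩
    ext i
    have hi := i.2
    simp only [ringInterval, Finset.mem_filter, Finset.mem_univ, true_and, mem_segment]
    constructor
    · rintro ⟨j, hj, e⟩
      rw [Nat.mod_eq_of_lt (by omega)] at e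
      omega
    · rintro ⟨h1, h2⟩
      exact ⟨i - a, by omega, by rw [Nat.mod_eq_of_lt (by omega)]; omega⟩
  -- An interval that wraps around omits exactly the sites from a + ℓ - n to a - 1.
  · refine ⟨a + ℓ - n, a, by omega, Or.inr ?_⟩
    ext i
    have hi := i.2
    simp only [ringInterval, Finset.mem_filter, Finset.mem_univ, true_and, mem_segment,
      Finset.mem_compl]
    constructor
    · rintro ⟨j, hj, e⟩
      by_cases hjn : (a : ℕ) + j < n
      · rw [Nat.mod_eq_of_lt hjn] at e
        omega
      · rw [Nat.mod_eq_sub_mod (by omega), Nat.mod_eq_of_lt (by omega)] at e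
        omega
    · intro h1
      by_cases h2 : (a : ℕ) ≤ i
      · exact ⟨i - a, by omega, by rw [Nat.mod_eq_of_lt (by omega)]; omega⟩
      · refine ⟨i + n - a, by omega, ?_⟩
        have : (a : ℕ) + (i + n - a) = i + n := by omega
        rw [this, Nat.add_mod_right, Nat.mod_eq_of_lt hi]

theorem filter_occList_congr {S : Finset (Fin n)} {y y' : Fin n → Bool}
    (h : ∀ i ∈ S, y i = y' i) : (occList y).filter (· ∈ S) = (occList y').filter (· ∈ S) := by
  rw [occList, occList, List.filter_filter, List.filter_filter]
  refine List.filter_congr fun i _ => ?_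
  by_cases hi : i ∈ S
  · simp [h i hi]
  · simp [hi]

theorem length_filter_add_length_filter_compl (S : Finset (Fin n)) (L : List (Fin n)) :
    (L.filter (· ∈ S)).length + (L.filter (· ∈ Sᶜ)).length = L.length := by
  rw [L.length_eq_length_filter_add (· ∈ S)]
  congr 2
  exact List.filter_congr fun i _ => by simp

theorem handPropagator_eq_listPropagator {M : ℕ} (u : Fin n → Op n (Fin 2))
    (t : HandConfig n M) : handPropagator u t = listPropagator u (occList (occ t)) := by
  rw [occList_occ, listPropagator, List.map_ofFn]
  rfl

/-- The occupation numbers determine the hands, so at most one term of the superposition survives: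
the spin state is controlled by the clock. -/
theorem clockEigenstate_apply {M : ℕ} (u : Fin n → Op n (Fin 2)) (φ : State n (Fin 2)) (θ : ℝ)
    (q : Fin M → Fin n) (x : Fin n → Fin 2 × Bool) :
    clockEigenstate u φ θ q x = (slaterCreate q θ *ᵥ vacuum n) (fun i => (x i).2) *
      (listPropagator u (occList fun i => (x i).2) *ᵥ φ) fun i => (x i).1 := by
  rw [slaterCreate_mulVec_vacuum, clockEigenstate, Finset.sum_apply, Finset.sum_apply,
    Finset.sum_mul]
  refine Finset.sum_congr rfl fun t _ => ?_
  rw [Pi.smul_apply, Pi.smul_apply, krylov, ladderTensor, handCreate_mulVec_vacuum, smul_eq_mul,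
    smul_eq_mul, mul_assoc]
  congr 1
  by_cases h : (fun i => (x i).2) = occ t
  · rw [h, handPropagator_eq_listPropagator, mul_comm]
  · rw [occState, Pi.single_eq_of_ne h, mul_zero, zero_mul]

theorem minSpinRenyi2_le {m M : ℕ} (hm : m < M + 1) (A : Finset (Fin n))
    (u : Fin n → Op n (Fin 2)) (φ : State n (Fin 2)) (t : HandConfig n m) :
    minSpinRenyi2 A u φ M ≤ renyi2 A (handPropagator u t *ᵥ φ) := by
  let s : Σ m : Fin (M + 1), HandConfig n m := ⟨⟨m, hm⟩, t⟩
  have h : minSpinRenyi2 A u φ M ≤ renyi2 A (handPropagator u s.2 *ᵥ φ) := by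
    unfold minSpinRenyi2
    exact Finset.inf'_le (fun t : Σ m : Fin (M + 1), HandConfig n m =>
      renyi2 A (handPropagator u t.2 *ᵥ φ)) (Finset.mem_univ s)
  exact h

/-- The entropy bound for a subsystem such that the spin states of the configurations of hands
agree up to local unitaries. -/
theorem renyi2_clockEigenstate_ge [NeZero n] {u : Fin n → Op n (Fin 2)}
    (hunitary : ∀ t, u t ∈ Matrix.unitaryGroup (Fin n → Fin 2) ℂ)
    (hlocal : ∀ t, SupportedOn {t, t + 1} (u t)) {φ : State n (Fin 2)} (hφ : φ ≠ 0) (θ : ℝ)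
    {M : ℕ} {q : Fin M → Fin n} (hq : Function.Injective q) {A : Finset (Fin n)}
    {V W : List (Fin n) → Op n (Fin 2)} {X : ℕ → State n (Fin 2)}
    (hV : ∀ L, V L ∈ localUnitary A) (hW : ∀ L, W L ∈ localUnitary Aᶜ)
    (hVW : ∀ L : List (Fin n), L.Pairwise (· < ·) → L.length = M → listPropagator u L *ᵥ φ =
      V (L.filter (· ∈ A)) *ᵥ W (L.filter (· ∈ Aᶜ)) *ᵥ X (L.filter (· ∈ A)).length) :
    renyi2 A (clockEigenstate u φ θ q) ≥
      renyi2 A (slaterCreate q θ *ᵥ vacuum n) + minSpinRenyi2 A u φ M := by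
  set C := slaterCreate q θ *ᵥ vacuum n with hCdef
  have hC : C ≠ 0 := by
    obtain ⟨t, ht⟩ := exists_slaterCoeff_ne_zero hq θ
    rw [← slaterCreate_mulVec_vacuum_occ] at ht
    exact fun H => ht (congrFun H _)
  have hlen : ∀ y, C y ≠ 0 → (occList y).length = M := by
    intro y hy
    obtain ⟨t, rfl⟩ := exists_occ_eq_of_ne_zero q θ hy
    rw [occList_occ, List.length_ofFn]
  have hne : ∀ y, listPropagator u (occList y) *ᵥ φ ≠ 0 := by
    intro y H
    have hU := (listPropagator_mem_localUnitary hunitary hlocal (L := occList y)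
      fun i _ => i.2).1
    apply hφ
    rw [← Matrix.one_mulVec φ, ← Matrix.mem_unitaryGroup_iff'.1 hU, ← Matrix.mulVec_mulVec, H,
      Matrix.mulVec_zero]
  have hP : ∀ y, C y ≠ 0 →
      purity A (listPropagator u (occList y) *ᵥ φ) ≤ Real.exp (-minSpinRenyi2 A u φ M) := by
    intro y hy
    rw [← Real.log_le_iff_le_exp (purity_pos A (hne y)), le_neg, ← renyi2_eq]
    obtain ⟨t, rfl⟩ := exists_occ_eq_of_ne_zero q θ hy
    rw [← handPropagator_eq_listPropagator]
    exact minSpinRenyi2_le M.lt_succ_self A u φ t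
  -- Padding with empty sites turns the hands inside `A` into a function of a alone; likewise off
  -- `A`.
  have hA : ∀ a b, (occList (glue A a b)).filter (· ∈ A) =
      (occList (glue A a fun _ => false)).filter (· ∈ A) := fun a b =>
    filter_occList_congr fun i hi => by rw [glue_mem _ _ _ hi, glue_mem _ _ _ hi]
  have hAc : ∀ a b, (occList (glue A a b)).filter (· ∈ Aᶜ) =
      (occList (glue A (fun _ => false) b)).filter (· ∈ Aᶜ) := fun a b =>
    filter_occList_congr fun i hi => by
      rw [Finset.mem_compl] at hi
      rw [glue_notMem _ _ _ hi, glue_notMem _ _ _ hi]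
  obtain ⟨hpos, hle⟩ := purity_ladder_pos_and_le (A := A) (C := C)
    (σ := fun y => listPropagator u (occList y) *ᵥ φ) (Ψ := clockEigenstate u φ θ q)
    (V := fun a => V ((occList (glue A a fun _ => false)).filter (· ∈ A)))
    (W := fun b => W ((occList (glue A (fun _ => false) b)).filter (· ∈ Aᶜ)))
    (X := fun a => X ((occList (glue A a fun _ => false)).filter (· ∈ A)).length)
    (clockEigenstate_apply u φ θ q) (fun _ => hV _) (fun _ => hW _)
    -- Conservation of the number of hands: both configurations have M hands in total and share
    -- those off `A`.
    (fun a a' b h h' => by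
      have e := length_filter_add_length_filter_compl A (occList (glue A a b))
      have e' := length_filter_add_length_filter_compl A (occList (glue A a' b))
      rw [hlen _ h, hA, hAc] at e
      rw [hlen _ h', hA, hAc] at e'
      congr 1
      omega)
    (fun a b h => by
      rw [hVW _ (occList_pairwise _) (hlen _ h), hA, hAc])
    hC (fun y _ => hne y) hP
  have h := Real.log_le_log hpos hle
  rw [Real.log_mul (purity_pos A hC).ne' (Real.exp_pos _).ne', Real.log_exp] at h
  rw [renyi2_eq, renyi2_eq]
  linarith

end Ladder

end SpinClock

end

/-! ### The main theorem. -/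

theorem mainTheorem4 {n : ℕ} [NeZero n]
    (u : Fin n → SpinClock.Op n (Fin 2))
    (hunitary : ∀ t, u t ∈ Matrix.unitaryGroup (Fin n → Fin 2) ℂ)
    (hlocal : ∀ t, SpinClock.SupportedOn {t, t + 1} (u t))
    (hlast : ∀ t : Fin n, (t : ℕ) + 1 = n → ∃ c : ℂ, u t = c • (1 : SpinClock.Op n (Fin 2)))
    (φ : SpinClock.State n (Fin 2)) (hφ : ∑ x, ‖φ x‖ ^ 2 = 1)
    (θ : ℝ)
    (hfloquet : SpinClock.propagator u n *ᵥ φ = Complex.exp (Complex.I * (θ : ℂ)) • φ)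
    {M : ℕ} (q : Fin M → Fin n) (hq : Function.Injective q)
    (a : Fin n) (ℓ : ℕ) (hℓ : ℓ ≤ n) :
    SpinClock.slaterCreate q θ = (List.ofFn fun j => SpinClock.planeWaveCreate (q j) θ).prod ∧
    SpinClock.renyi2 (SpinClock.ringInterval a ℓ) (SpinClock.clockEigenstate u φ θ q) ≥
      SpinClock.renyi2 (SpinClock.ringInterval a ℓ)
          (SpinClock.slaterCreate q θ *ᵥ SpinClock.vacuum n) +
        SpinClock.minSpinRenyi2 (SpinClock.ringInterval a ℓ) u φ M := by
  refine ⟨SpinClock.slaterCreate_eq_prod q θ, ?_⟩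
  have hφ0 : φ ≠ 0 := by
    rintro rfl
    simp at hφ
  obtain ⟨p, r, hpr, h⟩ := SpinClock.ringInterval_eq_segment_or_compl a hℓ
  obtain ⟨V, W, X, hV, hW, hVW⟩ :=
    SpinClock.exists_local_factorization hunitary hlocal hlast hfloquet hpr
  rcases h with h | h <;> rw [h]
  · refine SpinClock.renyi2_clockEigenstate_ge hunitary hlocal hφ0 θ hq (X := X) hV hW
      fun L hL _ => ?_
    rw [hVW L hL, Matrix.mulVec_mulVec, Matrix.mulVec_mulVec,
      SpinClock.localUnitary_commute (hV _) (hW _) disjoint_compl_right]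
  -- For the complement of a segment the two unitaries swap roles, and k hands in the complement
  -- leave M - k in the segment.
  · refine SpinClock.renyi2_clockEigenstate_ge hunitary hlocal hφ0 θ hq
      (X := fun k => X (M - k)) hW (fun L => by rw [compl_compl]; exact hV L) fun L hL hM => ?_
    have e := SpinClock.length_filter_add_length_filter_compl (SpinClock.segment n p r) L
    have e' : M - (L.filter (· ∈ (SpinClock.segment n p r)ᶜ)).length =
        (L.filter (· ∈ SpinClock.segment n p r)).length := by omega
    rw [hVW L hL, e']
    simp only [compl_compl]
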